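/- Let $G$ be a finite connected undirected (simple, unweighted) graph with adjacency matrix $A$ and Laplacian $L = D - A$, where $D$ is the diagonal matrix of vertex degrees, and write $e_i$ for the standard basis vector of vertex $v_i$. For a target vertex $v_\tau$, an attack vertex $v_a$ and a monitor vertex $v_m$, consider the system $$\dot x(t) = -L x(t) + e_a\, a(t),\qquad x(0)=0,\qquad y_\tau(t) = e_\tau^\top x(t),\qquad y_m(t) = e_m^\top x(t),\qquad t \ge 0,$$ with attack signals $a \in \mathcal L_{2e}$ (square-integrable on $[0,T]$ for every $0<T<\infty$), and put $\|y\|_{\mathcal L_2}^2 = \int_0^\infty y(t)^2\,dt \in [0,\infty]$. Let $v_m \neq v_\tau$ be a vertex such that every neighbour of $v_\tau$ other than $v_m$ itself is adjacent to $v_m$. Then, for every attack vertex $v_a \ne v_\tau$ for which the system $\Sigma_m = (-L, e_a, e_m^\top, 0)$ has no finite unstable invariant zero (that is, there are no $\lambda \in \mathbb C$ with $\operatorname{Re}\lambda \ge 0$, $0 \neq \bar x \in \mathbb C^N$ (with $N$ the number of vertices) and $g \in \mathbb C$ such that $(\lambda I + L)\bar x - e_a g = 0$ and $e_m^\top \bar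 x = 0$), the problem of minimizing $\gamma > 0$ subject to $$\|y_\tau\|_{\mathcal L_2}^2 \le \gamma\, \|y_m\|_{\mathcal L_2}^2 \quad \text{for all } a \in \mathcal L_{2e},\ x(0)=0,$$ is feasible, and the worst-case impact $\sup\{\|y_\tau\|_{\mathcal L_2}^2 : a \in \mathcal L_{2e},\ x(0)=0,\ \|y_m\|_{\mathcal L_2}^2 \le 1\}$ is finite. Moreover, $v_m$ satisfies $$e_\tau^\top A\,(I + A)\, e_m = e_\tau^\top A^2 e_\tau .$$ -/

import Mathlib

open MeasureTheory Set
open scoped ENNReal Matrix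

noncomputable section

namespace StealthyAttack

/-- The standard basis vector `e_i`. -/
def stdVec {V : Type*} [DecidableEq V] (i : V) : V → ℝ := Pi.single i 1

/-- The extended space `L_{2e}`: signals on the positive half-line that are square-integrable on
`[0, T]` for every `0 < T < ∞`. (Signals are functions on `ℝ` whose values at negative times are
never used.) -/
def MemL2e (u : ℝ → ℝ) : Prop :=
  ∀ T : ℝ, 0 < T → MemLp u 2 (volume.restrict (Icc 0 T))

/-- The energy `∫₀^∞ y(t)² dt` of a signal, a value in `[0, ∞]`. -/
def energy (y : ℝ → ℝ) : ℝ≥0∞ :=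
  ∫⁻ t in Ici (0 : ℝ), ENNReal.ofReal (y t ^ 2)

section Network

variable {V : Type*} [Fintype V] [DecidableEq V] (G : SimpleGraph V) [DecidableRel G.Adj]

/-- `x` is the state trajectory of `x' = -L x + e_a u`, `x(0) = 0`, on `[0, ∞)`, where `L` is the
Laplacian of `G`. As `u` is only locally square-integrable, solutions are meant in the
Carathéodory sense, i.e. `x` is continuous and satisfies the integrated equation. -/
def IsTrajectory (a : V) (u : ℝ → ℝ) (x : ℝ → V → ℝ) : Prop :=
  ContinuousOn x (Ici 0) ∧ x 0 = 0 ∧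
    ∀ t : ℝ, 0 ≤ t → x t = ∫ s in (0 : ℝ)..t, (-(G.lapMatrix ℝ) *ᵥ x s + u s • stdVec a)

/-- The feasible set of the problem
`min γ` over `γ > 0` subject to `‖y_τ‖² ≤ γ ‖y_m‖²` for all `u ∈ L_{2e}`, `x(0) = 0`,
for the target vertex `τ`, attack vertex `a` and monitor vertex `m`. -/
def feasibleGains (τ a m : V) : Set ℝ :=
  {γ | 0 < γ ∧ ∀ (u : ℝ → ℝ) (x : ℝ → V → ℝ), MemL2e u → IsTrajectory G a u x →
    energy (fun t => x t τ) ≤ ENNReal.ofReal γ * energy (fun t => x t m)}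

/-- The worst-case impact of a stealthy attack: the supremum of `‖y_τ‖²` over all `u ∈ L_{2e}`
with `x(0) = 0` and `‖y_m‖² ≤ 1`. -/
def worstCaseImpact (τ a m : V) : ℝ≥0∞ :=
  sSup {J | ∃ (u : ℝ → ℝ) (x : ℝ → V → ℝ), MemL2e u ∧ IsTrajectory G a u x ∧
    energy (fun t => x t m) ≤ 1 ∧ J = energy (fun t => x t τ)}

end Network

/-- `z` is a (finite) invariant zero of the single-input single-output system
`x' = A x + b u`, `y = cᵀ x`: there are `v ≠ 0` and `g` with `(z I - A) v - b g = 0`, `cᵀ v = 0`.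
The zero direction is complex, as `z` is. -/
def IsInvariantZero {n : Type*} [Fintype n] [DecidableEq n]
    (A : Matrix n n ℝ) (b c : n → ℝ) (z : ℂ) : Prop :=
  ∃ (v : n → ℂ) (g : ℂ), v ≠ 0 ∧
    (z • (1 : Matrix n n ℂ) - A.map (fun r => (r : ℂ))) *ᵥ v - g • (fun i => (b i : ℂ)) = 0 ∧
    (fun i => (c i : ℂ)) ⬝ᵥ v = 0

/-- The system has no finite unstable invariant zero, i.e. none in the closed right half-plane. -/
def NoUnstableZero {n : Type*} [Fintype n] [DecidableEq n]
    (A : Matrix n n ℝ) (b c : n → ℝ) : Prop :=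
  ∀ z : ℂ, 0 ≤ z.re → ¬ IsInvariantZero A b c z

end StealthyAttack

end

/-!
The statement says that the transfer function `H` from the monitor output to the target output is
proper and stable; such an `H` has a finite `L₂` gain `γ`, for trajectories of infinite energy too,
because the gain already bounds the energies over every interval `[0, T]`.

To avoid transforms and derivatives of nonsmooth signals, everything is written in terms of the
operator of integration from `0` on continuous signals (`primitive`), that is, in the variable
`X = 1 / s`. The state equation becomes `(1 + X L) x = e_a U`, with `U` the integral of the attack,
and the adjugate of `1 + X L` gives numerators `w i` (`numerator`) with
`det (1 + X L) • x i = w i • U`. As nonzero polynomials in the integration operator are injective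
(`aeval_primitive_injective`), it follows that `w m • y_τ = w τ • y_m`
(`IsTrajectory.aeval_numerator_comm`). So `H = w τ / w m`, about which three facts are needed.

* `w i` vanishes at `X = 0` to the order `dist a i` (`coeff_numerator_dist`). By the condition on the
  neighbours of `τ`, the vertex `m` is at most as far from `a` as `τ` is
  (`dist_le_dist_of_forall_adj`). Hence the power of `X` in `w m` cancels: `H` is proper.
* All `w i` have the same degree (`natDegree_numerator_eq`), because the kernel of the Laplacian of a
  connected graph consists of the constant vectors. Hence `H` has no pole at `s = 0`.
* `w m` is up to sign the determinant of the pencil bordered by input and output (`det_bordered`), so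
  a root `z ≠ 0` of `w m` gives the invariant zero `1 / z`
  (`isInvariantZero_of_aeval_numerator_eq_zero`). Hence all these roots have negative real part.

The gain of such a quotient is bounded factor by factor (`exists_gain_of_roots_re_neg`); for one
factor, `∫₀ᵗ h - z h = f` with `Re z < 0` bounds the energy of `h` by that of `f`, as one sees from
the derivative of `‖∫₀ᵗ h‖²`.
-/

namespace StealthyAttack

open Polynomial

/-! ### The integration operator -/

/-- Integration from `0`, `f ↦ ∫₀ᵗ f`, as a linear operator on the continuous complex signals. -/
noncomputable def primitive : Module.End ℂ C(ℝ, ℂ) where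
  toFun f := ⟨fun t => ∫ s in (0 : ℝ)..t, f s,
    intervalIntegral.continuous_primitive (fun a b => f.continuous.intervalIntegrable a b) 0⟩
  map_add' f g := by
    ext t
    exact intervalIntegral.integral_add (f.continuous.intervalIntegrable 0 t)
      (g.continuous.intervalIntegrable 0 t)
  map_smul' c f := by
    ext t
    exact intervalIntegral.integral_smul c f

theorem primitive_apply (f : C(ℝ, ℂ)) (t : ℝ) : primitive f t = ∫ s in (0 : ℝ)..t, f s := rfl

theorem hasDerivAt_primitive (f : C(ℝ, ℂ)) (t : ℝ) : HasDerivAt (primitive f) (f t) t :=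
  (f.continuous.integral_hasStrictDerivAt 0 t).hasDerivAt

theorem primitive_zero (f : C(ℝ, ℂ)) : primitive f 0 = 0 := by
  simp [primitive_apply]

/-- Integration from `0` has no eigenvector: `w = ∫₀ᵗ f` would solve `z w' = w`, `w 0 = 0`. -/
theorem eq_zero_of_primitive_eq_smul {z : ℂ} {f : C(ℝ, ℂ)} (h : primitive f = z • f) : f = 0 := by
  by_cases hz : z = 0
  · ext t
    have h0 : ⇑(primitive f) = fun _ => (0 : ℂ) := by
      rw [h, hz]; ext s; simp
    have := hasDerivAt_primitive f t
    rw [h0] at this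
    simpa using this.unique (hasDerivAt_const t (0 : ℂ))
  · have hf : ∀ t, f t = z⁻¹ * primitive f t := fun t => by
      rw [h]; simp [hz]
    have hd : ∀ t : ℝ, HasDerivAt (fun t : ℝ => Complex.exp (-(z⁻¹ * t)) * primitive f t) 0 t := by
      intro t
      have h1 : HasDerivAt (fun t : ℝ => Complex.exp (-(z⁻¹ * t)))
          (Complex.exp (-(z⁻¹ * t)) * (-(z⁻¹ * 1))) t :=
        ((((hasDerivAt_id (t : ℂ)).comp_ofReal).const_mul z⁻¹).neg).cexp
      refine (h1.mul (hasDerivAt_primitive f t)).congr_deriv ?_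
      rw [hf t]; ring
    have hc := is_const_of_deriv_eq_zero (fun t => (hd t).differentiableAt) (fun t => (hd t).deriv)
    ext t
    have := hc t 0
    simp only [primitive_zero, mul_zero, mul_eq_zero, Complex.exp_ne_zero, false_or] at this
    simp [hf t, this]

/-- The signals form a torsion-free module over the polynomials in the integration operator: over
`ℂ` a polynomial splits into linear factors, and integration has no eigenvector. -/
theorem aeval_primitive_injective {p : ℂ[X]} (hp : p ≠ 0) :
    Function.Injective (aeval primitive p) := by
  induction hn : p.natDegree generalizing p with
  | zero =>
    obtain ⟨c, rfl⟩ := natDegree_eq_zero.mp hn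
    have hc : c ≠ 0 := by simpa using hp
    intro f g hfg
    simp only [aeval_C, Module.algebraMap_end_apply] at hfg
    exact smul_right_injective _ hc hfg
  | succ n ih =>
    obtain ⟨z, hz⟩ := IsAlgClosed.exists_root p (by
      rw [degree_eq_natDegree hp, hn]; exact_mod_cast Nat.succ_ne_zero n)
    obtain ⟨r, rfl⟩ := dvd_iff_isRoot.mpr hz
    have hr : r ≠ 0 := right_ne_zero_of_mul hp
    rw [natDegree_mul (X_sub_C_ne_zero z) hr, natDegree_X_sub_C] at hn
    rw [map_mul, Module.End.coe_mul]
    refine Function.Injective.comp ?_ (ih hr (by omega))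
    rw [← LinearMap.ker_eq_bot, LinearMap.ker_eq_bot']
    intro f hf
    refine eq_zero_of_primitive_eq_smul (z := z) ?_
    simpa [sub_eq_zero] using hf

/-! ### Finite gain of stable proper transfer functions -/

/-- The equation `∫₀ᵗ h - z h = f` with `z ≠ 0` is solvable: `w = ∫₀ᵗ h` is given by variation of
constants for `w' = (w - f) / z`. -/
theorem exists_primitive_sub_smul_eq {z : ℂ} (hz : z ≠ 0) (f : C(ℝ, ℂ)) :
    ∃ h : C(ℝ, ℂ), primitive h - z • h = f := by
  let e : C(ℝ, ℂ) := ⟨fun t => Complex.exp (-(z⁻¹ * t)) * f t, by fun_prop⟩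
  let w : ℝ → ℂ := fun t => -z⁻¹ * (Complex.exp (z⁻¹ * t) * primitive e t)
  have hwc : Continuous w := by fun_prop
  let h : C(ℝ, ℂ) := ⟨fun t => z⁻¹ * (w t - f t), by fun_prop⟩
  have hw : ∀ t, HasDerivAt w (h t) t := by
    intro t
    have h1 : HasDerivAt (fun t : ℝ => Complex.exp (z⁻¹ * t))
        (Complex.exp (z⁻¹ * t) * (z⁻¹ * 1)) t :=
      (((hasDerivAt_id (t : ℂ)).comp_ofReal).const_mul z⁻¹).cexp
    refine ((h1.mul (hasDerivAt_primitive e t)).const_mul (-z⁻¹)).congr_deriv ?_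
    have he : Complex.exp (z⁻¹ * t) * e t = f t := by
      change Complex.exp (z⁻¹ * t) * (Complex.exp (-(z⁻¹ * t)) * f t) = f t
      rw [← mul_assoc, ← Complex.exp_add]; simp
    change _ = z⁻¹ * (-z⁻¹ * (Complex.exp (z⁻¹ * t) * primitive e t) - f t)
    rw [← he]; ring
  refine ⟨h, ?_⟩
  ext t
  have hp : primitive h t = w t := by
    rw [primitive_apply, intervalIntegral.integral_eq_sub_of_hasDerivAt (fun s _ => hw s)
      (h.continuous.intervalIntegrable 0 t)]
    simp [w, primitive_zero]
  have : z * h t = w t - f t := by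
    change z * (z⁻¹ * (w t - f t)) = _
    field_simp
  simp [hp, this]

/-- The energy estimate for `∫₀ᵗ h - z h = f` with `Re z < 0`, from the derivative of `‖∫₀ᵗ h‖²`. -/
theorem integral_norm_sq_le_of_primitive_sub_smul_eq {z : ℂ} (hz : z.re < 0) {f h : C(ℝ, ℂ)}
    (hf : primitive h - z • h = f) {T : ℝ} (hT : 0 ≤ T) :
    ∫ t in (0 : ℝ)..T, ‖h t‖ ^ 2 ≤ (z.re ^ 2)⁻¹ * ∫ t in (0 : ℝ)..T, ‖f t‖ ^ 2 := by
  have hd : ∀ t, HasDerivAt (fun t => ‖primitive h t‖ ^ 2) (2 * inner ℝ (primitive h t) (h t)) t :=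
    fun t => (hasDerivAt_primitive h t).norm_sq
  have hcont : Continuous fun t => 2 * inner ℝ (primitive h t) (h t) := by fun_prop
  have hint := intervalIntegral.integral_eq_sub_of_hasDerivAt (a := 0) (b := T)
    (fun s _ => hd s) (hcont.intervalIntegrable 0 T)
  have hpt : ∀ t, 2 * inner ℝ (primitive h t) (h t) ≤
      (-z.re)⁻¹ * ‖f t‖ ^ 2 - (-z.re) * ‖h t‖ ^ 2 := by
    intro t
    have hw : primitive h t = f t + z * h t := by rw [← hf]; simp
    have h1 : inner ℝ (primitive h t) (h t) = inner ℝ (f t) (h t) + z.re * ‖h t‖ ^ 2 := by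
      rw [hw, inner_add_left]
      congr 1
      rw [Complex.inner, Complex.sq_norm, Complex.normSq_apply]
      simp
      ring
    have h2 := real_inner_le_norm (f t) (h t)
    have hs : 0 < -z.re := by linarith
    have h3 : 2 * (‖f t‖ * ‖h t‖) ≤ (-z.re)⁻¹ * ‖f t‖ ^ 2 + (-z.re) * ‖h t‖ ^ 2 := by
      have : 0 ≤ (-z.re)⁻¹ * (‖f t‖ - (-z.re) * ‖h t‖) ^ 2 := by positivity
      have e : (-z.re)⁻¹ * (‖f t‖ - (-z.re) * ‖h t‖) ^ 2 =
        (-z.re)⁻¹ * ‖f t‖ ^ 2 + (-z.re) * ‖h t‖ ^ 2 - 2 * (‖f t‖ * ‖h t‖) := by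
        have := hz.ne
        field_simp
        ring
      linarith
    rw [h1]; linarith
  have hfi : IntervalIntegrable (fun t => (-z.re)⁻¹ * ‖f t‖ ^ 2) volume 0 T :=
    Continuous.intervalIntegrable (by fun_prop) _ _
  have hhi : IntervalIntegrable (fun t => (-z.re) * ‖h t‖ ^ 2) volume 0 T :=
    Continuous.intervalIntegrable (by fun_prop) _ _
  have hmono := intervalIntegral.integral_mono_on hT (hcont.intervalIntegrable 0 T) (hfi.sub hhi)
    (fun t _ => hpt t)
  rw [hint, intervalIntegral.integral_sub hfi hhi, intervalIntegral.integral_const_mul,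
    intervalIntegral.integral_const_mul, primitive_zero] at hmono
  have hs : 0 < -z.re := by linarith
  have h0 : 0 ≤ ‖primitive h T‖ ^ 2 := by positivity
  have key : -z.re * ∫ t in (0 : ℝ)..T, ‖h t‖ ^ 2 ≤ (-z.re)⁻¹ * ∫ t in (0 : ℝ)..T, ‖f t‖ ^ 2 := by
    simp only [norm_zero] at hmono
    linarith
  have hz' := hz.ne
  calc _ = (-z.re)⁻¹ * (-z.re * ∫ t in (0 : ℝ)..T, ‖h t‖ ^ 2) := by field_simp
    _ ≤ (-z.re)⁻¹ * ((-z.re)⁻¹ * ∫ t in (0 : ℝ)..T, ‖f t‖ ^ 2) := by gcongr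
    _ = _ := by field_simp

theorem integral_norm_sq_add_smul_le (c : ℂ) (f g : C(ℝ, ℂ)) {T : ℝ} (hT : 0 ≤ T) :
    ∫ t in (0 : ℝ)..T, ‖(f + c • g) t‖ ^ 2 ≤
      2 * (∫ t in (0 : ℝ)..T, ‖f t‖ ^ 2) + 2 * ‖c‖ ^ 2 * ∫ t in (0 : ℝ)..T, ‖g t‖ ^ 2 := by
  have hfi : IntervalIntegrable (fun t => 2 * ‖f t‖ ^ 2) volume 0 T :=
    Continuous.intervalIntegrable (by fun_prop) _ _
  have hgi : IntervalIntegrable (fun t => 2 * ‖c‖ ^ 2 * ‖g t‖ ^ 2) volume 0 T :=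
    Continuous.intervalIntegrable (by fun_prop) _ _
  rw [← intervalIntegral.integral_const_mul, ← intervalIntegral.integral_const_mul,
    ← intervalIntegral.integral_add hfi hgi]
  refine intervalIntegral.integral_mono_on hT (Continuous.intervalIntegrable (by fun_prop) _ _)
    (hfi.add hgi) fun t _ => ?_
  have h1 : ‖(f + c • g) t‖ ≤ ‖f t‖ + ‖c‖ * ‖g t‖ := by
    simpa using norm_add_le (f t) (c • g t)
  have h2 := pow_le_pow_left₀ (norm_nonneg _) h1 2
  nlinarith [sq_nonneg (‖f t‖ - ‖c‖ * ‖g t‖)]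

/-- The finite-gain property of a proper stable transfer function `q / p`, written in the
variable "integration" instead of "differentiation": the poles `1 / z` of the system are stable
exactly when the roots `z` of `p` have negative real part. Linear factors of `p` are removed one
at a time, each together with a factor of `q`, if there is one. -/
theorem exists_gain_of_roots_re_neg {p q : ℂ[X]} (hp : p ≠ 0) (hroot : ∀ z, p.IsRoot z → z.re < 0)
    (hdeg : q.natDegree ≤ p.natDegree) :
    ∃ C : ℝ, 0 ≤ C ∧ ∀ f g : C(ℝ, ℂ), aeval primitive p g = aeval primitive q f →
      ∀ T : ℝ, 0 ≤ T → ∫ t in (0 : ℝ)..T, ‖g t‖ ^ 2 ≤ C * ∫ t in (0 : ℝ)..T, ‖f t‖ ^ 2 := by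
  induction hn : p.natDegree generalizing p q with
  | zero =>
    obtain ⟨c, rfl⟩ := natDegree_eq_zero.mp hn
    obtain ⟨e, rfl⟩ := natDegree_eq_zero.mp (Nat.le_zero.mp (hdeg.trans hn.le))
    have hc : c ≠ 0 := by simpa using hp
    refine ⟨2 * ‖c⁻¹ * e‖ ^ 2, by positivity, fun f g hfg T hT => ?_⟩
    simp only [aeval_C, Module.algebraMap_end_apply] at hfg
    have hg : g = 0 + (c⁻¹ * e) • f := by
      rw [mul_smul, ← hfg, smul_smul, inv_mul_cancel₀ hc, one_smul, zero_add]
    have := integral_norm_sq_add_smul_le (c⁻¹ * e) 0 f hT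
    rw [← hg] at this
    simpa using this
  | succ n ih =>
    obtain ⟨z, hz⟩ := IsAlgClosed.exists_root p (by
      rw [degree_eq_natDegree hp, hn]; exact_mod_cast Nat.succ_ne_zero n)
    have hzre := hroot z hz
    have hz0 : z ≠ 0 := by rintro rfl; simp at hzre
    obtain ⟨r, rfl⟩ := dvd_iff_isRoot.mpr hz
    have hr : r ≠ 0 := right_ne_zero_of_mul hp
    rw [natDegree_mul (X_sub_C_ne_zero z) hr, natDegree_X_sub_C] at hn
    have hrn : r.natDegree = n := by omega
    have hXz : ∀ h : C(ℝ, ℂ), aeval primitive (X - C z) h = primitive h - z • h := by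
      intro h; simp
    obtain ⟨q', hq', K, hK, hfac⟩ : ∃ q' : ℂ[X], q'.natDegree ≤ r.natDegree ∧ ∃ K : ℝ, 0 ≤ K ∧
        ∀ f : C(ℝ, ℂ), ∃ f' : C(ℝ, ℂ),
          aeval primitive q f = aeval primitive ((X - C z) * q') f' ∧
          ∀ T : ℝ, 0 ≤ T → ∫ t in (0 : ℝ)..T, ‖f' t‖ ^ 2 ≤ K * ∫ t in (0 : ℝ)..T, ‖f t‖ ^ 2 := by
      by_cases hq : q.natDegree = 0
      · refine ⟨q, by omega, (z.re ^ 2)⁻¹, by positivity, fun f => ?_⟩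
        obtain ⟨h, hh⟩ := exists_primitive_sub_smul_eq hz0 f
        refine ⟨h, ?_, fun T hT => integral_norm_sq_le_of_primitive_sub_smul_eq hzre hh hT⟩
        rw [mul_comm, map_mul, Module.End.mul_apply, hXz, hh]
      · have hq0 : q ≠ 0 := by rintro rfl; simp at hq
        obtain ⟨a, ha⟩ := IsAlgClosed.exists_root q (by
          rw [degree_eq_natDegree hq0]; exact_mod_cast hq)
        obtain ⟨s, rfl⟩ := dvd_iff_isRoot.mpr ha
        have hs : s ≠ 0 := right_ne_zero_of_mul hq0
        rw [natDegree_mul (X_sub_C_ne_zero z) hr, natDegree_X_sub_C,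
          natDegree_mul (X_sub_C_ne_zero a) hs, natDegree_X_sub_C] at hdeg
        refine ⟨s, by omega, 2 + 2 * ‖z - a‖ ^ 2 * (z.re ^ 2)⁻¹, by positivity, fun f => ?_⟩
        obtain ⟨h, hh⟩ := exists_primitive_sub_smul_eq hz0 f
        -- `(X - a) / (X - z) = 1 + (z - a) / (X - z)`
        refine ⟨f + (z - a) • h, ?_, fun T hT => ?_⟩
        · rw [mul_comm, mul_comm _ s, map_mul, map_mul, Module.End.mul_apply,
            Module.End.mul_apply, hXz]
          congr 1
          ext t
          have ht : primitive h t - z * h t = f t := by rw [← hh]; simp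
          simp only [map_sub, aeval_X, aeval_C, LinearMap.sub_apply, Module.algebraMap_end_apply,
            map_add, map_smul, ContinuousMap.sub_apply, ContinuousMap.add_apply,
            ContinuousMap.smul_apply, smul_eq_mul]
          linear_combination (a - z) * ht
        · have h1 := integral_norm_sq_add_smul_le (z - a) f h hT
          have h2 := integral_norm_sq_le_of_primitive_sub_smul_eq hzre hh hT
          have h3 := mul_le_mul_of_nonneg_left h2 (by positivity : 0 ≤ 2 * ‖z - a‖ ^ 2)
          linarith
    obtain ⟨C', hC', hgain⟩ := ih (q := q') hr
      (fun y hy => hroot y (by simp only [IsRoot, eval_mul] at hy ⊢; rw [hy, mul_zero]))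
      hq' hrn
    refine ⟨C' * K, by positivity, fun f g hfg T hT => ?_⟩
    obtain ⟨f', hf', hfK⟩ := hfac f
    rw [hf', map_mul, map_mul, Module.End.mul_apply, Module.End.mul_apply] at hfg
    have := hgain f' g (aeval_primitive_injective (X_sub_C_ne_zero z) hfg) T hT
    have h2 := mul_le_mul_of_nonneg_left (hfK T hT) hC'
    linarith

/-! ### Numerators of the transfer functions of a linear system -/

section Pencil

variable {V : Type*} [Fintype V] [DecidableEq V]

/-- Expansion of a bordered determinant. -/
theorem det_bordered {R : Type*} [CommRing R] [IsDomain R] (A : Matrix V V R) (hA : A.det ≠ 0)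
    (b c : V → R) :
    (Matrix.fromBlocks A (Matrix.replicateCol Unit b) (Matrix.replicateRow Unit c) 0).det =
      -(c ⬝ᵥ (A.adjugate *ᵥ b)) := by
  -- clear the upper right block by a column operation that multiplies the determinant by `det A`
  have hmul : Matrix.fromBlocks A (Matrix.replicateCol Unit b) (Matrix.replicateRow Unit c) 0 *
      Matrix.fromBlocks 1 (Matrix.replicateCol Unit (-(A.adjugate *ᵥ b))) 0 (A.det • 1) =
      Matrix.fromBlocks A 0 (Matrix.replicateRow Unit c)
        ((-(c ⬝ᵥ (A.adjugate *ᵥ b))) • (1 : Matrix Unit Unit R)) := by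
    rw [Matrix.fromBlocks_multiply]
    congr 1
    · simp
    · ext i j
      have : (A *ᵥ (A.adjugate *ᵥ b)) i = A.det * b i := by
        rw [Matrix.mulVec_mulVec, Matrix.mul_adjugate, Matrix.smul_mulVec, Matrix.one_mulVec]; rfl
      rw [← Matrix.replicateCol_mulVec, Matrix.mulVec_neg]
      change -(A *ᵥ (A.adjugate *ᵥ b)) i +
        (Matrix.replicateCol Unit b * (A.det • (1 : Matrix Unit Unit R))) i j = 0
      simp [this, mul_comm, -Matrix.mulVec_mulVec]
    · simp
    · ext i j
      simp [Matrix.mul_apply, dotProduct]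
  have hdet := congrArg Matrix.det hmul
  rw [Matrix.det_mul, Matrix.det_fromBlocks_zero₂₁, Matrix.det_fromBlocks_zero₁₂] at hdet
  simp only [Matrix.det_one, one_mul, Matrix.det_smul, Fintype.card_unit, pow_one, mul_one] at hdet
  rw [mul_comm] at hdet
  exact mul_left_cancel₀ hA hdet

/-- The matrix `1 + X L` over `ℝ[X]`: with `X` read as integration from `0`, the integrated state
equation is `(1 + X L) x = b U`, `U` being the integral of the input. -/
noncomputable def integralPencil (L : Matrix V V ℝ) : Matrix V V ℝ[X] := 1 + (X : ℝ[X]) • L.map C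

/-- The vector `adj (1 + X L) b` of numerators of the transfer functions from the (integrated)
input to the single states, in the variable `X` = integration. -/
noncomputable def numerator (L : Matrix V V ℝ) (b : V → ℝ) : V → ℝ[X] :=
  (integralPencil L).adjugate *ᵥ fun i => C (b i)

theorem integralPencil_det_coeff_zero (L : Matrix V V ℝ) : (integralPencil L).det.coeff 0 = 1 := by
  have h := Polynomial.coeff_det_X_add_C_zero L (1 : Matrix V V ℝ)
  rw [Matrix.det_one] at h
  rw [← h, integralPencil, add_comm]
  simp

theorem integralPencil_det_ne_zero (L : Matrix V V ℝ) : (integralPencil L).det ≠ 0 := by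
  intro h
  simpa [h] using integralPencil_det_coeff_zero L

theorem integralPencil_mulVec_numerator (L : Matrix V V ℝ) (b : V → ℝ) :
    integralPencil L *ᵥ numerator L b = (integralPencil L).det • fun i => C (b i) := by
  rw [numerator, Matrix.mulVec_mulVec, Matrix.mul_adjugate, Matrix.smul_mulVec, Matrix.one_mulVec]

theorem integralPencil_mulVec_apply (L : Matrix V V ℝ) (w : V → ℝ[X]) (i : V) :
    (integralPencil L *ᵥ w) i = w i + X * ∑ j, C (L i j) * w j := by
  rw [integralPencil, Matrix.add_mulVec, Matrix.smul_mulVec, Matrix.one_mulVec]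
  rfl

theorem coeff_zero_numerator (L : Matrix V V ℝ) (b : V → ℝ) (i : V) :
    (numerator L b i).coeff 0 = b i := by
  have h := congrArg (fun p : ℝ[X] => p.coeff 0)
    (congrFun (integralPencil_mulVec_numerator L b) i)
  simp only [Pi.smul_apply, smul_eq_mul, mul_coeff_zero, coeff_C_zero,
    integralPencil_det_coeff_zero, one_mul, integralPencil_mulVec_apply, coeff_add, coeff_X_zero,
    zero_mul, add_zero] at h
  exact h

theorem coeff_succ_numerator (L : Matrix V V ℝ) (b : V → ℝ) (n : ℕ) (i : V) :
    (numerator L b i).coeff (n + 1) + (L *ᵥ fun j => (numerator L b j).coeff n) i =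
      (integralPencil L).det.coeff (n + 1) * b i := by
  have h := congrArg (fun p : ℝ[X] => p.coeff (n + 1))
    (congrFun (integralPencil_mulVec_numerator L b) i)
  simp only [Pi.smul_apply, smul_eq_mul, coeff_mul_C, integralPencil_mulVec_apply, coeff_add,
    coeff_X_mul, finsetSum_coeff, coeff_C_mul] at h
  exact h

/-- A complex root `z` of the numerator at `m` gives the invariant zero `1 / z`: the Rosenbrock
matrix at `1 / z` is, up to scaling, the pencil bordered by input and output, and its determinant
is the numerator. -/
theorem isInvariantZero_of_aeval_numerator_eq_zero (L : Matrix V V ℝ) (b : V → ℝ) (hb : b ≠ 0)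
    (m : V) {z : ℂ} (hz : z ≠ 0) (h : aeval z (numerator L b m) = 0) :
    IsInvariantZero (-L) b (stdVec m) z⁻¹ := by
  have hdet := det_bordered (integralPencil L) (integralPencil_det_ne_zero L) (fun i => C (b i))
    (Pi.single m 1)
  rw [single_one_dotProduct] at hdet
  have hdet' := congrArg (aeval z) hdet
  rw [map_neg, ← numerator, h, neg_zero, AlgHom.map_det] at hdet'
  obtain ⟨v, hv, hvz⟩ := Matrix.exists_mulVec_eq_zero_iff.mpr hdet'
  have hrow : ∀ i, v (Sum.inl i) + z * ∑ j, (L i j : ℂ) * v (Sum.inl j) +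
      (b i : ℂ) * v (Sum.inr ()) = 0 := by
    intro i
    have := congrFun hvz (Sum.inl i)
    simpa [Matrix.mulVec, dotProduct, Matrix.map_apply, integralPencil, Matrix.one_apply, add_mul,
      Finset.sum_add_distrib, Finset.mul_sum, mul_assoc, mul_left_comm z, apply_ite] using this
  have hout : v (Sum.inl m) = 0 := by
    have := congrFun hvz (Sum.inr ())
    simpa [Matrix.mulVec, dotProduct, Matrix.map_apply, Pi.single_apply, apply_ite] using this
  refine ⟨fun i => v (Sum.inl i), -(z⁻¹ * v (Sum.inr ())), ?_, ?_, ?_⟩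
  · intro h0
    have h0' : ∀ i, v (Sum.inl i) = 0 := fun i => congrFun h0 i
    obtain ⟨i, hi⟩ := Function.ne_iff.mp hb
    have hr : v (Sum.inr ()) = 0 := by
      have := hrow i
      simp only [h0', mul_zero, Finset.sum_const_zero, zero_add, mul_eq_zero] at this
      exact this.resolve_left (by exact_mod_cast hi)
    exact hv (funext fun k => by rcases k with k | k <;> simp [h0', hr])
  · ext i
    have hL : ((z⁻¹ • (1 : Matrix V V ℂ) - (-L).map fun r => (r : ℂ)) *ᵥ
        fun i => v (Sum.inl i)) i =
        z⁻¹ * v (Sum.inl i) + ∑ j, (L i j : ℂ) * v (Sum.inl j) := by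
      rw [Matrix.sub_mulVec, Matrix.smul_mulVec, Matrix.one_mulVec]
      simp [Matrix.mulVec, dotProduct]
    have hi := hrow i
    simp only [Pi.sub_apply, Pi.smul_apply, smul_eq_mul, Pi.zero_apply, hL]
    have : z⁻¹ * v (Sum.inl i) + ∑ j, (L i j : ℂ) * v (Sum.inl j) -
        -(z⁻¹ * v (Sum.inr ())) * (b i : ℂ) = z⁻¹ * (v (Sum.inl i) +
        z * ∑ j, (L i j : ℂ) * v (Sum.inl j) + (b i : ℂ) * v (Sum.inr ())) := by
      field_simp
      ring
    rw [this, hi, mul_zero]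
  · simpa [stdVec, dotProduct, Pi.single_apply, apply_ite] using hout

end Pencil

/-! ### Order and degree of the numerators of a network -/

section Network

variable {V : Type*} [Fintype V] [DecidableEq V] (G : SimpleGraph V) [DecidableRel G.Adj]

/-- The relative degree from `a` to `i` is governed by the distance: the off-diagonal entries of
`-L` are nonnegative and vanish off the edges, so the coefficients of order below `dist a i` vanish,
and that of order `dist a i` cannot cancel. -/
theorem coeff_numerator_dist (hG : G.Connected) (a : V) (n : ℕ) (i : V) :
    (n < G.dist a i → (numerator (G.lapMatrix ℝ) (stdVec a) i).coeff n = 0) ∧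
    (n = G.dist a i → 0 < (numerator (G.lapMatrix ℝ) (stdVec a) i).coeff n) := by
  induction n generalizing i with
  | zero =>
    rw [coeff_zero_numerator]
    constructor
    · intro h
      have : i ≠ a := by rintro rfl; simp at h
      simp [stdVec, this]
    · intro h
      have : a = i := hG.dist_eq_zero_iff.mp h.symm
      simp [stdVec, this]
  | succ n ih =>
    have hrec : n + 1 ≤ G.dist a i → (numerator (G.lapMatrix ℝ) (stdVec a) i).coeff (n + 1) =
        ∑ j ∈ G.neighborFinset i, (numerator (G.lapMatrix ℝ) (stdVec a) j).coeff n := by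
      intro h
      have hne : i ≠ a := by rintro rfl; simp at h
      have := coeff_succ_numerator (G.lapMatrix ℝ) (stdVec a) n i
      rw [SimpleGraph.lapMatrix_mulVec_apply, (ih i).1 (by omega)] at this
      simp only [stdVec, Pi.single_eq_of_ne hne, mul_zero] at this ⊢
      linarith
    constructor
    · intro h
      rw [hrec h.le]
      refine Finset.sum_eq_zero fun j hj => (ih j).1 ?_
      rw [SimpleGraph.mem_neighborFinset] at hj
      have := hj.diff_dist_adj (u := a)
      omega
    · intro h
      rw [hrec h.le]
      refine Finset.sum_pos' (fun j hj => ?_) ?_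
      · rw [SimpleGraph.mem_neighborFinset] at hj
        have hd := hj.diff_dist_adj (u := a)
        rcases (show n ≤ G.dist a j by omega).lt_or_eq with h' | h'
        · exact ((ih j).1 h').ge
        · exact ((ih j).2 h').le
      · obtain ⟨w, hw⟩ := hG.exists_walk_length_eq_dist i a
        rw [SimpleGraph.dist_comm, ← h] at hw
        cases w with
        | nil => simp at hw
        | @cons _ j _ hij w' =>
          rw [SimpleGraph.Walk.length_cons] at hw
          have h1 := SimpleGraph.dist_le w'
          rw [SimpleGraph.dist_comm] at h1
          have hd := hij.diff_dist_adj (u := a)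
          exact ⟨j, by simpa using hij, (ih j).2 (by omega)⟩

/-- All numerators have the same degree. Summing the state equation over the vertices shows that
the coefficient vectors of the numerators sum to the coefficients of the determinant; hence the
vector of top coefficients is in the kernel of the Laplacian, so it is constant. -/
theorem natDegree_numerator_eq (hG : G.Connected) (a i j : V) :
    (numerator (G.lapMatrix ℝ) (stdVec a) i).natDegree =
      (numerator (G.lapMatrix ℝ) (stdVec a) j).natDegree := by
  set w := numerator (G.lapMatrix ℝ) (stdVec a) with hw
  set M := Finset.univ.sup fun k => (w k).natDegree with hM
  have hle : ∀ k, (w k).natDegree ≤ M := fun k =>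
    Finset.le_sup (f := fun k => (w k).natDegree) (Finset.mem_univ k)
  have htop : ∀ k, (w k).coeff (M + 1) = 0 := fun k =>
    coeff_eq_zero_of_natDegree_lt (Nat.lt_succ_of_le (hle k))
  have hrec : ∀ k, ((G.lapMatrix ℝ) *ᵥ fun k => (w k).coeff M) k =
      (integralPencil (G.lapMatrix ℝ)).det.coeff (M + 1) * stdVec a k := fun k => by
    have := coeff_succ_numerator (G.lapMatrix ℝ) (stdVec a) M k
    rwa [← hw, htop, zero_add] at this
  have hd : (integralPencil (G.lapMatrix ℝ)).det.coeff (M + 1) = 0 := by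
    have h1 : (fun _ => (1 : ℝ)) ⬝ᵥ ((G.lapMatrix ℝ) *ᵥ fun k => (w k).coeff M) = 0 := by
      rw [Matrix.dotProduct_mulVec, ← Matrix.mulVec_transpose, (G.isSymm_lapMatrix ℝ).eq,
        G.lapMatrix_mulVec_const_eq_zero, zero_dotProduct]
    rw [dotProduct, Finset.sum_congr rfl fun k _ => by rw [hrec k]] at h1
    simpa [stdVec, Pi.single_apply] using h1
  have hker : (G.lapMatrix ℝ) *ᵥ (fun k => (w k).coeff M) = 0 := by
    ext k; rw [hrec, hd, zero_mul]; rfl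
  have hconst := (G.lapMatrix_mulVec_eq_zero_iff_forall_reachable).mp hker
  obtain ⟨k, -, hk⟩ := Finset.exists_mem_eq_sup Finset.univ ⟨a, Finset.mem_univ a⟩
    (fun k => (w k).natDegree)
  have hne : w k ≠ 0 := by
    intro h
    have := (coeff_numerator_dist G hG a _ k).2 rfl
    rw [← hw, h] at this
    simp at this
  have hck : (w k).coeff M ≠ 0 := by
    rw [hM, hk]; simpa using hne
  have : ∀ l, (w l).natDegree = M := fun l =>
    le_antisymm (hle l) (le_natDegree_of_ne_zero (by
      rwa [hconst l k (hG.preconnected l k)]))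
  rw [this, this]

end Network

/-! ### Signals and their energy -/

/-- A real signal on `[0, ∞)`, extended by its value at `0` and regarded as complex-valued. -/
noncomputable def extendSignal (y : ℝ → ℝ) (hy : ContinuousOn y (Ici 0)) : C(ℝ, ℂ) :=
  ⟨fun t => (y (max t 0) : ℂ), Complex.continuous_ofReal.comp
    (hy.comp_continuous (by fun_prop) fun t => le_max_right t 0)⟩

theorem extendSignal_apply {y : ℝ → ℝ} (hy : ContinuousOn y (Ici 0)) {t : ℝ} (ht : 0 ≤ t) :
    extendSignal y hy t = y t := by
  simp [extendSignal, max_eq_left ht]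

theorem extendSignal_of_nonpos {y : ℝ → ℝ} (hy : ContinuousOn y (Ici 0)) {t : ℝ} (ht : t ≤ 0) :
    extendSignal y hy t = y 0 := by
  simp [extendSignal, max_eq_right ht]

theorem primitive_extendSignal {y : ℝ → ℝ} (hy : ContinuousOn y (Ici 0)) {t : ℝ} (ht : 0 ≤ t) :
    primitive (extendSignal y hy) t = ((∫ s in (0 : ℝ)..t, y s : ℝ) : ℂ) := by
  rw [primitive_apply, ← intervalIntegral.integral_ofReal]
  refine intervalIntegral.integral_congr fun s hs => ?_
  rw [uIcc_of_le ht] at hs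
  exact extendSignal_apply hy hs.1

theorem primitive_extendSignal_of_nonpos {y : ℝ → ℝ} (hy : ContinuousOn y (Ici 0)) (h0 : y 0 = 0)
    {t : ℝ} (ht : t ≤ 0) : primitive (extendSignal y hy) t = 0 := by
  rw [primitive_apply]
  refine intervalIntegral.integral_zero_ae (Filter.Eventually.of_forall fun s hs => ?_)
  rw [uIoc_of_ge ht] at hs
  rw [extendSignal_of_nonpos hy hs.2, h0, Complex.ofReal_zero]

/-- A bound on the energies over all bounded intervals `[0, T]` passes to the limit. This also covers
signals of infinite energy, where the bound on `[0, ∞)` has no meaning for Bochner integrals. -/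
theorem energy_le_of_integral_le {y y' : ℝ → ℝ} (hy : ContinuousOn y (Ici 0))
    (hy' : ContinuousOn y' (Ici 0)) {C : ℝ} (hC : 0 ≤ C)
    (h : ∀ T : ℝ, 0 ≤ T → ∫ t in (0 : ℝ)..T, y t ^ 2 ≤ C * ∫ t in (0 : ℝ)..T, y' t ^ 2) :
    energy y ≤ ENNReal.ofReal C * energy y' := by
  have hfin : ∀ {f : ℝ → ℝ}, ContinuousOn f (Ici 0) → ∀ {T : ℝ}, 0 ≤ T →
      ∫⁻ t in Ioc 0 T, ENNReal.ofReal (f t ^ 2) =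
        ENNReal.ofReal (∫ t in (0 : ℝ)..T, f t ^ 2) := by
    intro f hf T hT
    rw [intervalIntegral.integral_of_le hT, ofReal_integral_eq_lintegral_ofReal]
    · exact ((hf.mono Icc_subset_Ici_self).pow 2).integrableOn_Icc.mono_set Ioc_subset_Icc_self
    · exact Filter.Eventually.of_forall fun t => sq_nonneg _
  have hunion : ⋃ n : ℕ, Ioc (0 : ℝ) n = Ioi 0 := by
    ext x
    simp only [mem_iUnion, mem_Ioc, mem_Ioi, exists_and_left, and_iff_left_iff_imp]
    exact fun _ => exists_nat_ge x
  have hmono : Directed (· ⊆ ·) fun n : ℕ => Ioc (0 : ℝ) n :=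
    Monotone.directed_le fun a b hab => Ioc_subset_Ioc_right (by exact_mod_cast hab)
  rw [energy, ← restrict_Ioi_eq_restrict_Ici, ← hunion, setLIntegral_iUnion_of_directed _ hmono]
  refine iSup_le fun n => ?_
  have hn : (0 : ℝ) ≤ n := n.cast_nonneg
  calc _ = ENNReal.ofReal (∫ t in (0 : ℝ)..n, y t ^ 2) := hfin hy hn
    _ ≤ ENNReal.ofReal (C * ∫ t in (0 : ℝ)..n, y' t ^ 2) := ENNReal.ofReal_le_ofReal (h n hn)
    _ = ENNReal.ofReal C * ∫⁻ t in Ioc (0 : ℝ) n, ENNReal.ofReal (y' t ^ 2) := by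
      rw [ENNReal.ofReal_mul hC, hfin hy' hn]
    _ ≤ _ := by
      gcongr
      exact lintegral_mono_set (Ioc_subset_Ioi_self.trans Ioi_subset_Ici_self)

/-! ### The input-output relation of a network -/

section Network

variable {V : Type*} [Fintype V] [DecidableEq V] {G : SimpleGraph V} [DecidableRel G.Adj]

theorem IsTrajectory.continuousOn_apply {a : V} {u : ℝ → ℝ}
    {x : ℝ → V → ℝ} (hx : IsTrajectory G a u x) (i : V) :
    ContinuousOn (fun t => x t i) (Ici 0) :=
  continuousOn_pi.mp hx.1 i

/-- The integrated state equation, one coordinate at a time and with the integrals of state and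
input separated. The input is integrable on `[0, t]` because it is square-integrable there. -/
theorem IsTrajectory.apply_eq {a : V} {u : ℝ → ℝ} {x : ℝ → V → ℝ} (hu : MemL2e u)
    (hx : IsTrajectory G a u x) (i : V) {t : ℝ} (ht : 0 ≤ t) :
    x t i + ∑ j, G.lapMatrix ℝ i j * ∫ s in (0 : ℝ)..t, x s j =
      stdVec a i * ∫ s in (0 : ℝ)..t, u s := by
  have hui : IntervalIntegrable u volume 0 t := by
    rcases ht.eq_or_lt with rfl | h
    · exact IntervalIntegrable.refl
    · rw [intervalIntegrable_iff_integrableOn_Icc_of_le ht]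
      exact (hu t h).integrable (by norm_num)
  have hxi : ∀ j, IntervalIntegrable (fun s => x s j) volume 0 t := fun j =>
    ((hx.continuousOn_apply j).mono (by rw [uIcc_of_le ht]; exact Icc_subset_Ici_self)
      ).intervalIntegrable
  have hcoord : ∀ s k, (-(G.lapMatrix ℝ) *ᵥ x s + u s • stdVec a) k =
      -(∑ j, G.lapMatrix ℝ k j * x s j) + stdVec a k * u s := by
    intro s k
    simp [Matrix.neg_mulVec, Matrix.mulVec, dotProduct, mul_comm]
  have hLi : ∀ k, IntervalIntegrable (fun s => ∑ j, G.lapMatrix ℝ k j * x s j) volume 0 t :=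
    fun k => by
      simpa only [Finset.sum_fn] using IntervalIntegrable.sum (μ := volume) Finset.univ
        (f := fun j s => G.lapMatrix ℝ k j * x s j) fun j _ => (hxi j).const_mul _
  have hci : ∀ k, IntervalIntegrable
      (fun s => (-(G.lapMatrix ℝ) *ᵥ x s + u s • stdVec a) k) volume 0 t := fun k => by
    simp only [hcoord]
    exact (hLi k).neg.add (hui.const_mul _)
  have hvi : IntervalIntegrable (fun s => -(G.lapMatrix ℝ) *ᵥ x s + u s • stdVec a) volume 0 t := by
    simp only [intervalIntegrable_iff_integrableOn_Ioc_of_le ht] at hci ⊢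
    exact Integrable.of_eval hci
  have h := congrFun (hx.2.2 t ht) i
  have hproj := (ContinuousLinearMap.proj (R := ℝ) (φ := fun _ : V => ℝ) i
    ).intervalIntegral_comp_comm hvi
  simp only [ContinuousLinearMap.proj_apply] at hproj
  rw [← hproj] at h
  simp only [hcoord] at h
  have hadd := intervalIntegral.integral_add (hLi i).neg (hui.const_mul (stdVec a i))
  have hsum := intervalIntegral.integral_finsetSum (s := Finset.univ)
    fun j _ => (hxi j).const_mul (G.lapMatrix ℝ i j)
  simp only [Pi.neg_apply, intervalIntegral.integral_neg,
    intervalIntegral.integral_const_mul] at hadd hsum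
  rw [hadd, hsum] at h
  linarith

/-- The relation between two outputs of the same trajectory, obtained by eliminating the input
from `(1 + X L) x = b U` with the adjugate and cancelling the determinant. -/
theorem IsTrajectory.aeval_numerator_comm {a : V} {u : ℝ → ℝ}
    {x : ℝ → V → ℝ} (hu : MemL2e u) (hx : IsTrajectory G a u x) (i k : V) :
    aeval primitive (numerator (G.lapMatrix ℝ) (stdVec a) k)
        (extendSignal _ (hx.continuousOn_apply i)) =
      aeval primitive (numerator (G.lapMatrix ℝ) (stdVec a) i)
        (extendSignal _ (hx.continuousOn_apply k)) := by
  set L := G.lapMatrix ℝ with hL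
  set Y : V → C(ℝ, ℂ) := fun j => extendSignal _ (hx.continuousOn_apply j) with hY
  have h0 : ∀ j, x 0 j = 0 := fun j => congrFun hx.2.1 j
  -- the integral of the input; its continuity is read off from the state equation
  set U : C(ℝ, ℂ) := Y a + ∑ j, (L a j : ℂ) • primitive (Y j) with hU
  have hstate : ∀ l, Y l + ∑ j, (L l j : ℂ) • primitive (Y j) = (stdVec a l : ℂ) • U := by
    have key : ∀ l t, (Y l + ∑ j, (L l j : ℂ) • primitive (Y j)) t =
        (stdVec a l : ℂ) * if 0 ≤ t then ((∫ s in (0 : ℝ)..t, u s : ℝ) : ℂ) else 0 := by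
      intro l t
      simp only [ContinuousMap.add_apply, ContinuousMap.sum_apply, ContinuousMap.smul_apply,
        smul_eq_mul, hY]
      split_ifs with ht
      · simp only [extendSignal_apply _ ht, primitive_extendSignal _ ht]
        exact_mod_cast hx.apply_eq hu l ht
      · have ht' := (not_le.mp ht).le
        have hP : ∀ j, primitive (extendSignal _ (hx.continuousOn_apply j)) t = 0 := fun j =>
          primitive_extendSignal_of_nonpos (hx.continuousOn_apply j) (h0 j) ht'
        simp [extendSignal_of_nonpos _ ht', hP, h0]
    intro l
    ext t
    rw [key, ContinuousMap.smul_apply, hU, key]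
    simp [stdVec]
  have hpencil : ∀ l, ∑ j, aeval primitive (integralPencil L l j) (Y j) =
      aeval primitive (C (stdVec a l)) U := by
    intro l
    have : ∀ j, aeval primitive (integralPencil L l j) (Y j) =
        (if l = j then Y j else 0) + (L l j : ℂ) • primitive (Y j) := by
      intro j
      have he : integralPencil L l j = (if l = j then 1 else 0) + C (L l j) * X := by
        rw [mul_comm, ← Matrix.one_apply]
        rfl
      rw [he, map_add, map_mul, aeval_C, aeval_X, LinearMap.add_apply, Module.End.mul_apply,
        Module.algebraMap_end_apply]
      congr 1
      split_ifs <;> simp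
    rw [Finset.sum_congr rfl fun j _ => this j, Finset.sum_add_distrib]
    simp only [Finset.sum_ite_eq, Finset.mem_univ, if_true]
    rw [hstate]
    ext t
    simp
  have hdet : ∀ l, aeval primitive (integralPencil L).det (Y l) =
      aeval primitive (numerator L (stdVec a) l) U := by
    intro l
    have h1 : ∑ k, aeval primitive ((integralPencil L).adjugate l k)
        (∑ j, aeval primitive (integralPencil L k j) (Y j)) =
        aeval primitive (integralPencil L).det (Y l) := by
      simp only [map_sum, ← Module.End.mul_apply, ← map_mul]
      rw [Finset.sum_comm]
      simp only [← LinearMap.sum_apply, ← map_sum, ← Matrix.mul_apply, Matrix.adjugate_mul]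
      rw [Finset.sum_eq_single l]
      · simp
      · intro j _ hj
        simp [hj.symm]
      · simp
    rw [← h1, numerator]
    simp only [hpencil, Matrix.mulVec, dotProduct, map_sum, map_mul, LinearMap.sum_apply,
      Module.End.mul_apply]
  have hinj : Function.Injective (aeval primitive (integralPencil L).det) := by
    rw [← aeval_map_algebraMap ℂ]
    exact aeval_primitive_injective
      ((Polynomial.map_ne_zero_iff (algebraMap ℝ ℂ).injective).mpr (integralPencil_det_ne_zero L))
  apply hinj
  change aeval primitive (integralPencil L).det (aeval primitive (numerator L (stdVec a) k) (Y i)) =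
    aeval primitive (integralPencil L).det (aeval primitive (numerator L (stdVec a) i) (Y k))
  have hcomm : ∀ (p q : ℝ[X]) (f : C(ℝ, ℂ)),
      aeval primitive p (aeval primitive q f) = aeval primitive q (aeval primitive p f) := by
    intro p q f
    rw [← Module.End.mul_apply, ← map_mul, mul_comm, map_mul, Module.End.mul_apply]
  rw [hcomm, hdet, hcomm _ _ (Y k), hdet, hcomm]

/-! ### The neighbourhood condition and the gain from the monitor to the target -/

/-- The last step of a shortest path from `a` to `τ` starts at a neighbour of `τ`, which is `m` or
is adjacent to `m`. -/
theorem dist_le_dist_of_forall_adj {V : Type*} {G : SimpleGraph V} (hG : G.Connected) {τ m : V}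
    (hm : ∀ w : V, G.Adj τ w → w ≠ m → G.Adj m w) {a : V} (ha : a ≠ τ) :
    G.dist a m ≤ G.dist a τ := by
  obtain ⟨w, hw⟩ := hG.exists_walk_length_eq_dist τ a
  rw [G.dist_comm (u := a) (v := τ), ← hw]
  cases w with
  | nil => exact absurd rfl ha
  | @cons _ j _ hj w' =>
    rw [SimpleGraph.Walk.length_cons]
    by_cases hjm : j = m
    · subst hjm
      have := SimpleGraph.dist_le w'
      rw [SimpleGraph.dist_comm] at this
      omega
    · have := SimpleGraph.dist_le (SimpleGraph.Walk.cons (hm j hj hjm) w')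
      rwa [SimpleGraph.dist_comm] at this

/-- If the attack vertex is at least as close to the monitor as to the target and there is no
unstable invariant zero, then the transfer function from the monitor output to the target output is
proper and stable, so the target energy is bounded by a multiple of the monitor energy. -/
theorem exists_gain (hG : G.Connected) {τ a m : V} (hdist : G.dist a m ≤ G.dist a τ)
    (hzero : NoUnstableZero (-(G.lapMatrix ℝ)) (stdVec a) (stdVec m)) :
    ∃ γ : ℝ, 0 ≤ γ ∧ ∀ (u : ℝ → ℝ) (x : ℝ → V → ℝ), MemL2e u → IsTrajectory G a u x →
      energy (fun t => x t τ) ≤ ENNReal.ofReal γ * energy (fun t => x t m) := by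
  set w := numerator (G.lapMatrix ℝ) (stdVec a) with hw
  have hne : ∀ i, w i ≠ 0 := by
    intro i h
    have := (coeff_numerator_dist G hG a _ i).2 rfl
    rw [← hw, h] at this
    simp at this
  -- cancel the common power of `X`
  obtain ⟨p, hp, hp0⟩ := (w m).exists_eq_pow_rootMultiplicity_mul_and_not_dvd (hne m) 0
  set k := (w m).rootMultiplicity 0
  rw [C_0, sub_zero] at hp hp0
  have hk : k ≤ G.dist a m := by
    by_contra hlt
    have := (coeff_numerator_dist G hG a _ m).2 rfl
    rw [← hw, hp, coeff_X_pow_mul', if_neg (by omega)] at this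
    exact this.false
  obtain ⟨q, hq⟩ : X ^ k ∣ w τ := X_pow_dvd_iff.mpr fun d hd =>
    (coeff_numerator_dist G hG a d τ).1 (by omega)
  have hpne : p ≠ 0 := by rintro rfl; exact hne m (by rw [hp, mul_zero])
  have hqne : q ≠ 0 := by rintro rfl; exact hne τ (by rw [hq, mul_zero])
  have hdeg : q.natDegree = p.natDegree := by
    have := natDegree_numerator_eq G hG a τ m
    rw [← hw, hp, hq, natDegree_X_pow_mul _ hqne, natDegree_X_pow_mul _ hpne] at this
    omega
  have hinj : Function.Injective (algebraMap ℝ ℂ) := (algebraMap ℝ ℂ).injective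
  obtain ⟨γ, hγ, hgain⟩ := exists_gain_of_roots_re_neg (p := p.map (algebraMap ℝ ℂ))
    (q := q.map (algebraMap ℝ ℂ)) ((Polynomial.map_ne_zero_iff hinj).mpr hpne)
    (by
      intro z hz
      rw [IsRoot, eval_map_algebraMap] at hz
      have hz0 : z ≠ 0 := by
        rintro rfl
        rw [X_dvd_iff] at hp0
        rw [← coeff_zero_eq_aeval_zero'] at hz
        exact hp0 (by simpa using hz)
      by_contra hre
      -- `Re z ≥ 0` makes `1 / z` an unstable zero
      refine hzero z⁻¹ ?_ (isInvariantZero_of_aeval_numerator_eq_zero _ _ ?_ m hz0 ?_)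
      · rw [Complex.inv_re]
        exact div_nonneg (not_lt.mp hre) (Complex.normSq_nonneg z)
      · intro h
        simpa [stdVec] using congrFun h a
      · rw [← hw, hp, map_mul, hz, mul_zero])
    (by rw [natDegree_map_eq_of_injective hinj, natDegree_map_eq_of_injective hinj, hdeg])
  refine ⟨γ, hγ, fun u x hu hx => ?_⟩
  refine energy_le_of_integral_le (hx.continuousOn_apply τ) (hx.continuousOn_apply m) hγ
    fun T hT => ?_
  have hrel := hx.aeval_numerator_comm hu τ m
  rw [← hw, hp, hq, map_mul, map_mul, Module.End.mul_apply, Module.End.mul_apply,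
    ← aeval_map_algebraMap ℂ (primitive) (X ^ k), ← aeval_map_algebraMap ℂ primitive p,
    ← aeval_map_algebraMap ℂ primitive q] at hrel
  have hrel' := aeval_primitive_injective
    ((Polynomial.map_ne_zero_iff hinj).mpr (pow_ne_zero k X_ne_zero)) hrel
  have hbound := hgain _ _ hrel' T hT
  have hnorm : ∀ i, ∫ t in (0 : ℝ)..T, ‖extendSignal _ (hx.continuousOn_apply i) t‖ ^ 2 =
      ∫ t in (0 : ℝ)..T, x t i ^ 2 := by
    intro i
    refine intervalIntegral.integral_congr fun t ht => ?_
    rw [uIcc_of_le hT] at ht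
    simp only [extendSignal_apply _ ht.1, Complex.norm_real, Real.norm_eq_abs, sq_abs]
  rwa [hnorm, hnorm] at hbound

/-- The neighbours of `τ` contribute `1` each on both sides: on the left as the edge `τ m` or as a
common neighbour of `τ` and `m`, on the right as the walk to the neighbour and back. -/
theorem adjMatrix_mul_one_add_adjMatrix_apply {τ m : V}
    (hm : ∀ w : V, G.Adj τ w → w ≠ m → G.Adj m w) :
    (G.adjMatrix ℝ * (1 + G.adjMatrix ℝ)) τ m = (G.adjMatrix ℝ ^ 2) τ τ := by
  rw [pow_two, Matrix.mul_apply, Matrix.mul_apply]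
  refine Finset.sum_congr rfl fun j _ => ?_
  by_cases hj : G.Adj τ j
  · by_cases hjm : j = m
    · subst hjm
      simp [SimpleGraph.adjMatrix_apply, hj, hj.symm]
    · simp [SimpleGraph.adjMatrix_apply, hj, hj.symm, hjm, (hm j hj hjm).symm]
  · simp [SimpleGraph.adjMatrix_apply, hj]

end Network

end StealthyAttack

theorem lemma2 {V : Type*} [Fintype V] [DecidableEq V] (G : SimpleGraph V) [DecidableRel G.Adj]
    (hG : G.Connected) (τ m : V) (hmτ : m ≠ τ)
    (hm : ∀ w : V, G.Adj τ w → w ≠ m → G.Adj m w) :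
    (∀ a : V, a ≠ τ →
      StealthyAttack.NoUnstableZero (-(G.lapMatrix ℝ))
        (StealthyAttack.stdVec a) (StealthyAttack.stdVec m) →
      (StealthyAttack.feasibleGains G τ a m).Nonempty ∧
        StealthyAttack.worstCaseImpact G τ a m < ⊤) ∧
    StealthyAttack.stdVec τ ⬝ᵥ ((G.adjMatrix ℝ * (1 + G.adjMatrix ℝ)) *ᵥ StealthyAttack.stdVec m) =
      StealthyAttack.stdVec τ ⬝ᵥ ((G.adjMatrix ℝ ^ 2) *ᵥ StealthyAttack.stdVec τ) := by
  refine ⟨fun a ha hzero => ?_, ?_⟩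
  · obtain ⟨γ, hγ, hgain⟩ := StealthyAttack.exists_gain hG
      (StealthyAttack.dist_le_dist_of_forall_adj hG hm ha) hzero
    refine ⟨⟨γ + 1, by positivity, fun u x hu hx => (hgain u x hu hx).trans ?_⟩, ?_⟩
    · gcongr
      linarith
    · refine lt_of_le_of_lt (sSup_le ?_) (ENNReal.ofReal_lt_top (r := γ))
      rintro _ ⟨u, x, hu, hx, hy, rfl⟩
      exact (hgain u x hu hx).trans (mul_le_of_le_one_right' hy)
  · simpa [StealthyAttack.stdVec] using
      StealthyAttack.adjMatrix_mul_one_add_adjMatrix_apply hm
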